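/- Let $K$ be a field. For a finite simple graph $G$ with vertex set $V$ and edge set $E$, the cut ideal $I_G$ is the kernel of the $K$-algebra homomorphism $$K[q_{A|B}] \to K[s_e,t_e : e\in E],\qquad q_{A|B}\mapsto \prod_{e\in \mathrm{Cut}(A|B)} s_e \prod_{e\in E\setminus \mathrm{Cut}(A|B)} t_e,$$ where $A|B$ runs over the unordered partitions $V=A\sqcup B$ (one part may be empty) and $\mathrm{Cut}(A|B)$ is the set of edges with one endpoint in $A$ and the other in $B$. Let $n\ge 1$ and let $C_{n+1}$ be the cycle on $n+1$ vertices (for $n=1$, the graph with two vertices and one edge). Then the cut ideal $I_{C_{n+1}}$ is minimally generated by $3\cdot S(n+1,4)$ quadratic binomials, where $S(m,k)$ denotes the Stirling number of the second kind. That is, $I_{C_{n+1}}$ has a generating set, no proper subset of which generates, consisting of exactly $3\cdot S(n+1,4)$ differences of two distinct monomials of degree $2$; moreover, every generating set of $I_{C_{n+1}}$ has at least $3\cdot S(n+1,4)$ elements, and every inclusion-minimal generating set of homogeneous polynomials has exactly $3\cdot S(n+1,4)$ elements. -/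

import Mathlib

/-- Unordered partitions `A|B` of the set `V` into two complementary parts
(one of which may be empty). -/
def UnorderedSplit (V : Type*) : Type _ :=
  {p : Sym2 (Set V) // ∃ A : Set V, p = s(A, Aᶜ)}

/-- The cut `Cut(A|B)` of `G`: the set of edges `{i, j}` of `G` with `i` in one part
of the partition `A|B` and `j` in the other part. -/
def SimpleGraph.cutSet {V : Type*} (G : SimpleGraph V) (P : UnorderedSplit V) :
    Set (Sym2 V) :=
  {e | e ∈ G.edgeSet ∧ ∃ A B : Set V, P.1 = s(A, B) ∧ ∃ i ∈ A, ∃ j ∈ B, e = s(i, j)}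

open scoped Classical in
/-- The homomorphism `K[q_{A|B}] → K[s_e, t_e : e edge of G]` that maps `q_{A|B}` to the product
of the `s_e` over the edges in `Cut(A|B)` and of the `t_e` over the remaining edges. The variable
`s_e` ("separated") is `X (Sum.inl e)`, the variable `t_e` ("together") is `X (Sum.inr e)`. -/
noncomputable def SimpleGraph.cutMap (K : Type*) [Field K] {V : Type*} (G : SimpleGraph V)
    [Fintype G.edgeSet] :
    MvPolynomial (UnorderedSplit V) K →ₐ[K] MvPolynomial (G.edgeSet ⊕ G.edgeSet) K :=
  MvPolynomial.aeval fun P =>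
    ∏ e : G.edgeSet,
      if (e : Sym2 V) ∈ G.cutSet P then MvPolynomial.X (Sum.inl e) else MvPolynomial.X (Sum.inr e)

/-- The cut ideal of `G`: the kernel of `G.cutMap K`. -/
noncomputable def SimpleGraph.cutIdeal (K : Type*) [Field K] {V : Type*} (G : SimpleGraph V)
    [Fintype G.edgeSet] : Ideal (MvPolynomial (UnorderedSplit V) K) :=
  RingHom.ker (G.cutMap K)

/-- A quadratic binomial: a difference of two distinct monomials of degree two. -/
def MvPolynomial.IsQuadraticBinomial {σ K : Type*} [Field K] (f : MvPolynomial σ K) : Prop :=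
  ∃ a b : σ →₀ ℕ, a ≠ b ∧ a.degree = 2 ∧ b.degree = 2 ∧
    f = MvPolynomial.monomial a 1 - MvPolynomial.monomial b 1

/-- `S` generates the ideal `I`, and no proper subset of `S` generates `I`. -/
def Ideal.IsMinimalGeneratingSet {R : Type*} [CommRing R] (I : Ideal R) (S : Set R) : Prop :=
  Ideal.span S = I ∧ ∀ T : Set R, T ⊂ S → Ideal.span T ≠ I

open MvPolynomial

/-! A split of the cycle is recorded by the vector over `ZMod 2` that marks its cut edges. The
vectors that occur are exactly those with even sum, each from one split. A monomial is thus a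
multiset of even rows, and two monomials have the same image iff their multisets show the same bits
in every column. Differences of such monomials generate the kernel.

Quadrics suffice: any two multisets with equal columns are connected by moves that exchange two
entries between two rows. The heart is `exists_mem_of_isSwapClosed`, an extremal argument that
brings a prescribed row `y` of the target into the multiset; then `y` is cancelled and induction
applies.

Subtracting from each degree 2 monomial a chosen representative of its fibre gives linearly
independent quadrics, and a graded Nakayama argument makes their number the minimal number of
generators. It equals the number of monomials minus the number of fibres, `C(2^n + 1, 2) - (3^(n+1)
- 2^(n+1) + 1)/2`, which is `3 * S(n+1, 4)`. -/

theorem encard_le_encard_of_linearIndepOn {K M : Type*} [Field K] [AddCommGroup M] [Module K M]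
    {B W : Set M} (hB : LinearIndepOn K id B) (h : B ⊆ Submodule.span K W) :
    B.encard ≤ W.encard := by
  have h1 := toENat_rank_span_set hB
  rw [Set.image_id] at h1
  rw [← h1, ← Set.toENat_cardinalMk]
  exact Cardinal.toENat.monotone'
    ((Submodule.rank_mono (Submodule.span_le.2 h)).trans (rank_span_le W))

/-! ### Minimal generators of an ideal generated in a single degree. -/

namespace MvPolynomial

variable {σ K : Type*} [Field K] {d : ℕ}

/-- Nonconstant terms of `p` push every term of `f` above degree `d`. So in the lowest degree, ideal
membership reduces to `K`-linear algebra. -/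
theorem homogeneousComponent_mul_of_coeff_eq_zero (p : MvPolynomial σ K) {f : MvPolynomial σ K}
    (hf : ∀ a : σ →₀ ℕ, a.degree < d → coeff a f = 0) :
    homogeneousComponent d (p * f) = coeff 0 p • homogeneousComponent d f := by
  classical
  ext a
  rw [coeff_homogeneousComponent, coeff_smul, coeff_homogeneousComponent]
  split_ifs with ha
  · rw [coeff_mul, smul_eq_mul]
    refine Finset.sum_eq_single_of_mem (0, a) (by simp) ?_
    rintro ⟨b, c⟩ hbc hne
    rw [Finset.HasAntidiagonal.mem_antidiagonal] at hbc
    simp only at hbc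
    rw [hf c, mul_zero]
    have hb : b ≠ 0 := by
      rintro rfl
      exact hne (by simpa using hbc)
    have hb' : b.degree ≠ 0 := fun h => hb ((Finsupp.degree_eq_zero_iff b).1 h)
    have : b.degree + c.degree = d := by rw [← ha, ← hbc, map_add]
    omega
  · simp

theorem coeff_eq_zero_of_mem_span {S : Set (MvPolynomial σ K)}
    (hS : ∀ s ∈ S, ∀ a : σ →₀ ℕ, a.degree < d → coeff a s = 0) {f : MvPolynomial σ K}
    (hf : f ∈ Ideal.span S) (a : σ →₀ ℕ) (ha : a.degree < d) : coeff a f = 0 := by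
  classical
  induction hf using Submodule.span_induction generalizing a with
  | mem x hx => exact hS x hx a ha
  | zero => simp
  | add x y _ _ hx hy => rw [coeff_add, hx a ha, hy a ha, add_zero]
  | smul p x _ hx =>
    rw [smul_eq_mul, coeff_mul]
    refine Finset.sum_eq_zero ?_
    rintro ⟨b, c⟩ hbc
    rw [Finset.HasAntidiagonal.mem_antidiagonal] at hbc
    simp only at hbc
    rw [hx c, mul_zero]
    have : b.degree + c.degree = a.degree := by rw [← hbc, map_add]
    omega

theorem homogeneousComponent_mem_span {S : Set (MvPolynomial σ K)}
    (hS : ∀ s ∈ S, ∀ a : σ →₀ ℕ, a.degree < d → coeff a s = 0) {f : MvPolynomial σ K}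
    (hf : f ∈ Ideal.span S) :
    homogeneousComponent d f ∈ Submodule.span K (homogeneousComponent d '' S) := by
  induction hf using Submodule.span_induction with
  | mem x hx => exact Submodule.subset_span ⟨x, hx, rfl⟩
  | zero => simp
  | add x y _ _ hx hy => rw [map_add]; exact add_mem hx hy
  | smul p x hx' hx =>
    rw [smul_eq_mul,
      homogeneousComponent_mul_of_coeff_eq_zero p (coeff_eq_zero_of_mem_span hS hx')]
    exact Submodule.smul_mem _ _ hx

theorem IsHomogeneous.coeff_eq_zero_of_degree_lt {f : MvPolynomial σ K} (hf : f.IsHomogeneous d)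
    (a : σ →₀ ℕ) (ha : a.degree < d) : coeff a f = 0 :=
  hf.coeff_eq_zero ha.ne

theorem span_subset_ideal_span (S : Set (MvPolynomial σ K)) :
    (Submodule.span K S : Set (MvPolynomial σ K)) ⊆ Ideal.span S :=
  Submodule.span_subset_span K (MvPolynomial σ K) S

section MinimalGenerators

variable {I : Ideal (MvPolynomial σ K)} {B : Set (MvPolynomial σ K)}

/-- A generating set of an ideal generated in degree `d` spans its degree `d` part. -/
theorem subset_span_homogeneousComponent_image (hhom : ∀ b ∈ B, b.IsHomogeneous d)
    (hspan : Ideal.span B = I) {S : Set (MvPolynomial σ K)} (hS : Ideal.span S = I) :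
    B ⊆ Submodule.span K (homogeneousComponent d '' S) := by
  intro b hb
  have hlow : ∀ s ∈ S, ∀ a : σ →₀ ℕ, a.degree < d → coeff a s = 0 := fun s hs =>
    coeff_eq_zero_of_mem_span (fun b hb => (hhom b hb).coeff_eq_zero_of_degree_lt)
      (by rw [hspan, ← hS]; exact Ideal.subset_span hs)
  have := homogeneousComponent_mem_span (d := d) hlow (f := b)
    (by rw [hS, ← hspan]; exact Ideal.subset_span hb)
  rwa [homogeneousComponent_eq_self (hhom b hb)] at this

/-- `S` need not be homogeneous: the degree `d` components of its elements already span `B` over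
`K`. -/
theorem encard_le_encard_of_span_eq (hli : LinearIndepOn K id B)
    (hhom : ∀ b ∈ B, b.IsHomogeneous d) (hspan : Ideal.span B = I)
    {S : Set (MvPolynomial σ K)} (hS : Ideal.span S = I) : B.encard ≤ S.encard :=
  (encard_le_encard_of_linearIndepOn hli
    (subset_span_homogeneousComponent_image hhom hspan hS)).trans (Set.encard_image_le _ _)

theorem isMinimalGeneratingSet_of_linearIndepOn (hfin : B.Finite) (hli : LinearIndepOn K id B)
    (hhom : ∀ b ∈ B, b.IsHomogeneous d) (hspan : Ideal.span B = I) :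
    I.IsMinimalGeneratingSet B := by
  refine ⟨hspan, fun T hT hTI => ?_⟩
  have h1 := encard_le_encard_of_span_eq hli hhom hspan hTI
  have h2 := (hfin.subset hT.subset).encard_lt_encard hT
  exact absurd h1 (not_le.2 h2)

/-- Generators of degree other than `d` have zero degree `d` component, hence are redundant; what
remains is a `K`-basis of the span of `B`. Homogeneity matters: `{x^2, x - x^2}` is an
inclusion-minimal generating set of `(x)`. -/
theorem encard_eq_of_isMinimalGeneratingSet (hli : LinearIndepOn K id B)
    (hhom : ∀ b ∈ B, b.IsHomogeneous d) (hspan : Ideal.span B = I)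
    {S : Set (MvPolynomial σ K)} (hShom : ∀ f ∈ S, ∃ e : ℕ, f.IsHomogeneous e)
    (hS : I.IsMinimalGeneratingSet S) : S.encard = B.encard := by
  -- Minimality in linear form: a subset of `S` whose `K`-span contains `B` generates `I`, so it is
  -- all of `S`.
  have hgen : ∀ T ⊆ S, B ⊆ Submodule.span K T → T = S := by
    intro T hTS hT
    by_contra hne
    refine hS.2 T (hTS.ssubset_of_ne hne) (le_antisymm ?_ ?_)
    · rw [← hS.1]
      exact Ideal.span_mono hTS
    · rw [← hspan]
      exact Ideal.span_le.2 (hT.trans (span_subset_ideal_span T))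
  have hdeg : {s ∈ S | s.IsHomogeneous d} = S := by
    refine hgen _ (Set.sep_subset _ _) ?_
    refine (subset_span_homogeneousComponent_image hhom hspan hS.1).trans ?_
    refine Submodule.span_le.2 ?_
    rintro _ ⟨s, hs, rfl⟩
    obtain ⟨e, he⟩ := hShom s hs
    by_cases hed : e = d
    · subst hed
      rw [homogeneousComponent_eq_self he]
      exact Submodule.subset_span ⟨hs, he⟩
    · rw [homogeneousComponent_of_mem he, if_neg (Ne.symm hed)]
      exact zero_mem _
  have hd : ∀ s ∈ S, s.IsHomogeneous d := fun s hs => by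
    rw [← hdeg] at hs
    exact hs.2
  have himage : ∀ T : Set (MvPolynomial σ K), (∀ t ∈ T, t.IsHomogeneous d) →
      homogeneousComponent d '' T = T := fun T hT => by
    exact (Set.image_congr fun t ht => homogeneousComponent_eq_self (hT t ht)).trans
      (Set.image_id' T)
  have hBS := subset_span_homogeneousComponent_image hhom hspan hS.1
  have hSB := subset_span_homogeneousComponent_image hd hS.1 hspan
  rw [himage S hd] at hBS
  rw [himage B hhom] at hSB
  have hSli : LinearIndepOn K id S := by
    obtain ⟨T, hTS, hT, hTli⟩ := exists_linearIndependent K S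
    rw [hgen T hTS (by rw [hT]; exact hBS)] at hTli
    exact hTli
  exact le_antisymm (encard_le_encard_of_linearIndepOn hSli hSB)
    (encard_le_encard_of_linearIndepOn hli hBS)

end MinimalGenerators

end MvPolynomial

/-! ### Kernels of monomial maps are generated by binomials. -/

namespace MvPolynomial

variable {σ τ K : Type*} [Field K]

/-- The monomial `∏ X s` over the multiset `s`. -/
noncomputable def multisetMonomial (K : Type*) [Field K] {σ : Type*} (s : Multiset σ) :
    MvPolynomial σ K := (s.map X).prod

theorem multisetMonomial_add (s t : Multiset σ) :
    multisetMonomial K (s + t) = multisetMonomial K s * multisetMonomial K t := by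
  simp [multisetMonomial]

theorem multisetMonomial_eq_monomial [DecidableEq σ] (s : Multiset σ) :
    multisetMonomial K s = monomial (Multiset.toFinsupp s) 1 := by
  induction s using Multiset.induction with
  | empty => simp [multisetMonomial]
  | cons a s ih =>
    rw [← Multiset.singleton_add, multisetMonomial_add, ih, map_add, Multiset.toFinsupp_singleton,
      ← one_mul (1 : K), ← monomial_mul, one_mul]
    simp [multisetMonomial, X]

theorem ker_le_of_multisetMonomial_sub_mem {φ : MvPolynomial σ K →ₐ[K] MvPolynomial τ K}
    {u : σ → τ →₀ ℕ} (hφ : ∀ x, φ (X x) = monomial (u x) 1) {J : Ideal (MvPolynomial σ K)}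
    (hJ : ∀ s t : Multiset σ, (s.map u).sum = (t.map u).sum →
      multisetMonomial K s - multisetMonomial K t ∈ J) :
    RingHom.ker φ ≤ J := by
  classical
  set U : (σ →₀ ℕ) → (τ →₀ ℕ) := fun a => ((Finsupp.toMultiset a).map u).sum with hU
  have hφm : ∀ a c, φ (monomial a c) = monomial (U a) c := by
    intro a c
    have h1 : monomial a c = C c * multisetMonomial K (Finsupp.toMultiset a) := by
      rw [multisetMonomial_eq_monomial, Finsupp.toMultiset_toFinsupp, C_mul_monomial, mul_one]
    have h2 : ∀ s : Multiset σ, φ (multisetMonomial K s) = monomial (s.map u).sum 1 := by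
      intro s
      induction s using Multiset.induction with
      | empty => simp [multisetMonomial]
      | cons x s ih =>
        rw [← Multiset.singleton_add, multisetMonomial_add, map_mul, ih]
        simp [multisetMonomial, hφ, monomial_mul]
    rw [h1, map_mul, h2, ← algebraMap_eq, AlgHom.commutes, algebraMap_eq, C_mul_monomial, mul_one]
  -- A linear section up to `J`: each monomial in the image goes to a chosen preimage. Then `f - ψ
  -- (φ f)` lies in `J`, and it equals `f` on the kernel.
  let ψ : MvPolynomial τ K →ₗ[K] MvPolynomial σ K :=
    (basisMonomials τ K).constr K fun c => monomial (Function.invFun U c) 1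
  have hψ : ∀ c, ψ (monomial c 1) = monomial (Function.invFun U c) 1 := by
    intro c
    have := (basisMonomials τ K).constr_basis K
      (fun c => (monomial (Function.invFun U c) (1 : K) : MvPolynomial σ K)) c
    rwa [coe_basisMonomials] at this
  have key : ∀ f, f - ψ (φ f) ∈ J := by
    intro f
    induction f using MvPolynomial.induction_on' with
    | monomial a c =>
      have hc : (monomial a c : MvPolynomial σ K) = c • monomial a 1 := by
        rw [smul_monomial, smul_eq_mul, mul_one]
      rw [hc, map_smul, map_smul, ← smul_sub, hφm, hψ, smul_eq_C_mul]
      refine J.mul_mem_left _ ?_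
      have hinv : U (Function.invFun U (U a)) = U a := Function.invFun_eq ⟨a, rfl⟩
      have := hJ (Finsupp.toMultiset a) (Finsupp.toMultiset (Function.invFun U (U a))) hinv.symm
      simpa only [multisetMonomial_eq_monomial, Finsupp.toMultiset_toFinsupp] using this
    | add p q hp hq =>
      rw [map_add, map_add, add_sub_add_comm]
      exact J.add_mem hp hq
  intro f hf
  have := key f
  rwa [RingHom.mem_ker.1 hf, map_zero, sub_zero] at this

end MvPolynomial

/-! ### Multisets of binary rows with equal columns. -/

/-- Two multisets of binary vectors agree in every coordinate, as multisets of bits. -/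
def SameColumns {σ ι : Type*} (row : σ → ι → ZMod 2) (s t : Multiset σ) : Prop :=
  ∀ (i : ι) (b : ZMod 2), s.countP (fun x => row x i = b) = t.countP (fun x => row x i = b)

namespace SameColumns

variable {σ ι : Type*} {row : σ → ι → ZMod 2} {s t u : Multiset σ}

theorem symm (h : SameColumns row s t) : SameColumns row t s := fun i b => (h i b).symm

theorem trans (h : SameColumns row s t) (h' : SameColumns row t u) : SameColumns row s u :=
  fun i b => (h i b).trans (h' i b)

theorem add_right (h : SameColumns row s t) (u : Multiset σ) :
    SameColumns row (s + u) (t + u) := fun i b => by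
  rw [Multiset.countP_add, Multiset.countP_add, h i b]

theorem of_cons {x : σ} (h : SameColumns row (x ::ₘ s) (x ::ₘ t)) : SameColumns row s t :=
  fun i b => by simpa [Multiset.countP_cons] using h i b

theorem card_eq [Nonempty ι] (h : SameColumns row s t) : s.card = t.card := by
  obtain ⟨i⟩ := ‹Nonempty ι›
  have key : ∀ s : Multiset σ, s.card =
      s.countP (fun x => row x i = 0) + s.countP (fun x => row x i = 1) := by
    intro s
    rw [Multiset.card_eq_countP_add_countP (fun x => row x i = 0) s]
    congr 1
    refine Multiset.countP_congr rfl fun x _ => ?_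
    generalize row x i = b
    revert b
    decide
  rw [key s, key t, h i 0, h i 1]

/-- Hamming distance is a sum over coordinates, and each coordinate contributes the number of rows
whose bit differs from that of `v`, a column invariant. -/
theorem sum_hammingDist_eq [Fintype ι] (h : SameColumns row s t) (v : ι → ZMod 2) :
    (s.map fun x => hammingDist (row x) v).sum = (t.map fun x => hammingDist (row x) v).sum := by
  have key : ∀ s : Multiset σ, (s.map fun x => hammingDist (row x) v).sum =
      ∑ i, s.countP (fun x => row x i = v i + 1) := by
    intro s
    induction s using Multiset.induction with
    | empty => simp
    | cons x s ih =>
      simp only [Multiset.map_cons, Multiset.sum_cons, ih, Multiset.countP_cons,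
        Finset.sum_add_distrib]
      rw [add_comm, hammingDist, Finset.card_filter]
      congr 1
      refine Finset.sum_congr rfl fun i _ => if_congr ?_ rfl rfl
      generalize row x i = b
      generalize v i = c
      revert b c
      decide
  rw [key s, key t]
  exact Finset.sum_congr rfl fun i _ => h i _

end SameColumns

theorem ZMod.add_one_eq_of_ne_two {a b : ZMod 2} (h : a ≠ b) : a + 1 = b := by
  revert a b
  decide

/-! ### Connectivity under exchanges between two rows. -/

section Connectivity

variable {σ ι : Type*} [DecidableEq ι] {row : σ → ι → ZMod 2}

/-- The vector `v` with the entries `i` and `j` changed. -/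
def flipTwo (v : ι → ZMod 2) (i j : ι) : ι → ZMod 2 := v + Pi.single i 1 + Pi.single j 1

theorem flipTwo_of_ne (v : ι → ZMod 2) {i j k : ι} (hi : k ≠ i) (hj : k ≠ j) :
    flipTwo v i j k = v k := by
  simp [flipTwo, hi, hj]

theorem flipTwo_left (v : ι → ZMod 2) {i j : ι} (h : i ≠ j) : flipTwo v i j i = v i + 1 := by
  simp [flipTwo, h]

theorem flipTwo_right (v : ι → ZMod 2) {i j : ι} (h : i ≠ j) : flipTwo v i j j = v j + 1 := by
  simp [flipTwo, h.symm]

/-- Exchanging two entries in which two rows differ does not change the columns. -/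
theorem sameColumns_flipTwo {x z x' z' : σ} {i j : ι} (hij : i ≠ j) (hi : row x i ≠ row z i)
    (hj : row x j ≠ row z j) (hx : row x' = flipTwo (row x) i j)
    (hz : row z' = flipTwo (row z) i j) :
    SameColumns row ({x, z} : Multiset σ) {x', z'} := by
  intro k b
  have hpair : ∀ p q : σ, ({p, q} : Multiset σ) = p ::ₘ q ::ₘ 0 := fun _ _ => rfl
  simp only [hpair, Multiset.countP_cons, Multiset.countP_zero, hx, hz]
  -- For distinct bits, exchanging them is the same as adding 1 to both.
  have hsw : ∀ p q b : ZMod 2, p ≠ q → ((0 + if q = b then 1 else 0) + if p = b then 1 else 0) =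
      (0 + if q + 1 = b then 1 else 0) + if p + 1 = b then 1 else 0 := by decide
  by_cases hki : k = i
  · subst hki
    rw [flipTwo_left _ hij, flipTwo_left _ hij]
    exact hsw _ _ b hi
  by_cases hkj : k = j
  · subst hkj
    rw [flipTwo_right _ hij, flipTwo_right _ hij]
    exact hsw _ _ b hj
  rw [flipTwo_of_ne _ hki hkj, flipTwo_of_ne _ hki hkj]

variable [Fintype ι]

theorem sum_flipTwo (v : ι → ZMod 2) (i j : ι) : ∑ k, flipTwo v i j k = ∑ k, v k := by
  simp only [flipTwo, Pi.add_apply, Finset.sum_add_distrib, Finset.sum_pi_single', Finset.mem_univ,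
    if_true]
  rw [add_assoc, show (1 : ZMod 2) + 1 = 0 from rfl, add_zero]

/-- A family of multisets of rows that is closed under exchanging two entries between two rows. -/
def IsSwapClosed (row : σ → ι → ZMod 2) (A : Set (Multiset σ)) : Prop :=
  ∀ (x z x' z' : σ) (r : Multiset σ) (i j : ι), x ::ₘ z ::ₘ r ∈ A → i ≠ j → row x i ≠ row z i →
    row x j ≠ row z j → row x' = flipTwo (row x) i j → row z' = flipTwo (row z) i j →
    x' ::ₘ z' ::ₘ r ∈ A

variable {A : Set (Multiset σ)} {x₀ y : σ} {a : Multiset σ}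

/-- Otherwise exchanging the entries `i` and `j` of `x₀` and `z` would bring `x₀` closer to `y`,
against the minimality of its distance. -/
theorem not_two_agreements (heven : ∀ v : ι → ZMod 2, (∃ x, row x = v) ↔ ∑ i, v i = 0)
    (hA : IsSwapClosed row A)
    (hmin : ∀ a ∈ A, ∀ x ∈ a, hammingDist (row x₀) (row y) ≤ hammingDist (row x) (row y))
    (ha : a ∈ A) (hx : x₀ ∈ a) {z : σ} (hz : z ∈ a) {i j : ι} (hij : i ≠ j)
    (hi : row x₀ i ≠ row y i) (hj : row x₀ j ≠ row y j) (hzi : row z i = row y i) :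
    row z j ≠ row y j := by
  intro hzj
  obtain ⟨r, rfl⟩ := Multiset.exists_cons_of_mem hx
  have hzx : z ≠ x₀ := by
    rintro rfl
    exact hi hzi
  obtain ⟨r, rfl⟩ := Multiset.exists_cons_of_mem ((Multiset.mem_cons.1 hz).resolve_left hzx)
  obtain ⟨x', hx'⟩ := (heven (flipTwo (row x₀) i j)).2
    (by rw [sum_flipTwo]; exact (heven _).1 ⟨_, rfl⟩)
  obtain ⟨z', hz'⟩ := (heven (flipTwo (row z) i j)).2
    (by rw [sum_flipTwo]; exact (heven _).1 ⟨_, rfl⟩)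
  have hmem := hA x₀ z x' z' r i j ha hij (by rwa [hzi]) (by rwa [hzj]) hx' hz'
  refine absurd (hmin _ hmem x' (Multiset.mem_cons_self _ _)) (not_le.2 ?_)
  refine Finset.card_lt_card ((Finset.ssubset_iff_of_subset ?_).2 ⟨i, ?_, ?_⟩)
  · intro k
    simp only [Finset.mem_filter, Finset.mem_univ, true_and, hx']
    by_cases hki : k = i
    · subst hki
      exact fun _ => hi
    by_cases hkj : k = j
    · subst hkj
      exact fun _ => hj
    rw [flipTwo_of_ne _ hki hkj]
    exact id
  · simpa using hi
  · simp [hx', flipTwo_left _ hij, ZMod.add_one_eq_of_ne_two hi]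

/-- If `z` and `w` differed at a third place `k`, exchanging their entries `j` and `k` would make
`z` agree with `y` at both `i` and `j`, with `x₀` still present; `not_two_agreements` forbids this.
-/
theorem add_single_eq_add_single (heven : ∀ v : ι → ZMod 2, (∃ x, row x = v) ↔ ∑ i, v i = 0)
    (hA : IsSwapClosed row A)
    (hmin : ∀ a ∈ A, ∀ x ∈ a, hammingDist (row x₀) (row y) ≤ hammingDist (row x) (row y))
    (ha : a ∈ A) (hx : x₀ ∈ a) {z w : σ} (hz : z ∈ a) (hw : w ∈ a) {i j : ι} (hij : i ≠ j)
    (hi : row x₀ i ≠ row y i) (hj : row x₀ j ≠ row y j) (hzi : row z i = row y i)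
    (hwj : row w j = row y j) :
    row z + Pi.single i 1 = row w + Pi.single j 1 := by
  have hzj := not_two_agreements heven hA hmin ha hx hz hij hi hj hzi
  have hwi := not_two_agreements heven hA hmin ha hx hw hij.symm hj hi hwj
  funext k
  by_cases hki : k = i
  · subst hki
    simpa [hij, hzi] using ZMod.add_one_eq_of_ne_two hwi.symm
  by_cases hkj : k = j
  · subst hkj
    simpa [hij.symm, hwj] using (ZMod.add_one_eq_of_ne_two hzj.symm).symm
  simp only [Pi.add_apply, Pi.single_eq_of_ne hki, Pi.single_eq_of_ne hkj, add_zero]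
  by_contra hk
  have hzx : x₀ ≠ z := by
    rintro rfl
    exact hi hzi
  have hwx : x₀ ≠ w := by
    rintro rfl
    exact hj hwj
  have hwz : w ≠ z := by
    rintro rfl
    exact hzj hwj
  obtain ⟨r, rfl⟩ := Multiset.exists_cons_of_mem hz
  obtain ⟨r, rfl⟩ := Multiset.exists_cons_of_mem ((Multiset.mem_cons.1 hw).resolve_left hwz)
  have hxr : x₀ ∈ r := by simpa [hzx, hwx] using hx
  obtain ⟨z', hz'⟩ := (heven (flipTwo (row z) j k)).2
    (by rw [sum_flipTwo]; exact (heven _).1 ⟨_, rfl⟩)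
  obtain ⟨w', hw'⟩ := (heven (flipTwo (row w) j k)).2
    (by rw [sum_flipTwo]; exact (heven _).1 ⟨_, rfl⟩)
  have hmem := hA z w z' w' r j k ha (Ne.symm hkj) (by rwa [hwj]) hk hz' hw'
  refine not_two_agreements heven hA hmin hmem (by simp [hxr]) (Multiset.mem_cons_self z' _) hij
    hi hj ?_ ?_
  · rw [hz', flipTwo_of_ne _ hij (Ne.symm hki), hzi]
  · rw [hz', flipTwo_left _ (Ne.symm hkj)]
    exact ZMod.add_one_eq_of_ne_two hzj

/-- Every row other than the chosen copy of `x₀` is a neighbour of the one odd vector `v = row z +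
e_i`. A row that agrees with `y` somewhere `x₀` does not is covered by `add_single_eq_add_single`.
Any other row `p` matches `v` at `i` and `j`; were it at distance greater than 1, exchanging two
differing entries with `z` would change `z + e_i` but not `w + e_j`. -/
theorem hammingDist_add_single_eq_one
    (heven : ∀ v : ι → ZMod 2, (∃ x, row x = v) ↔ ∑ i, v i = 0)
    (hA : IsSwapClosed row A)
    (hmin : ∀ a ∈ A, ∀ x ∈ a, hammingDist (row x₀) (row y) ≤ hammingDist (row x) (row y))
    (ha : x₀ ::ₘ a ∈ A) {z w : σ} (hz : z ∈ a) (hw : w ∈ a) {i j : ι} (hij : i ≠ j)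
    (hi : row x₀ i ≠ row y i) (hj : row x₀ j ≠ row y j) (hzi : row z i = row y i)
    (hwj : row w j = row y j) {p : σ} (hp : p ∈ a) :
    hammingDist (row p) (row z + Pi.single i 1) = 1 := by
  have hxa := Multiset.mem_cons_self x₀ a
  have hzw := add_single_eq_add_single heven hA hmin ha hxa (Multiset.mem_cons_of_mem hz)
    (Multiset.mem_cons_of_mem hw) hij hi hj hzi hwj
  have hone : ∀ l, row p + Pi.single l 1 = row z + Pi.single i 1 →
      hammingDist (row p) (row z + Pi.single i 1) = 1 := by
    intro l hl
    rw [← hl, hammingDist, Finset.card_eq_one]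
    refine ⟨l, ?_⟩
    ext k
    by_cases hkl : k = l
    · subst hkl
      simp
    · simp [hkl]
  by_cases hT : ∃ l, row x₀ l ≠ row y l ∧ row p l = row y l
  · obtain ⟨l, hl, hpl⟩ := hT
    refine hone l ?_
    by_cases hli : l = i
    · subst hli
      rw [hzw]
      exact add_single_eq_add_single heven hA hmin ha hxa (Multiset.mem_cons_of_mem hp)
        (Multiset.mem_cons_of_mem hw) hij hl hj hpl hwj
    · exact add_single_eq_add_single heven hA hmin ha hxa (Multiset.mem_cons_of_mem hp)
        (Multiset.mem_cons_of_mem hz) hli hl hi hpl hzi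
  · push Not at hT
    have hpi := hT i hi
    have hpj := hT j hj
    have hzj := not_two_agreements heven hA hmin ha hxa (Multiset.mem_cons_of_mem hz) hij hi hj hzi
    have hodd : ∃ l, row p l ≠ (row z + Pi.single i 1 : ι → ZMod 2) l := by
      by_contra! hall
      have h1 : ∑ l, row p l = ∑ l, (row z + Pi.single i 1 : ι → ZMod 2) l :=
        Finset.sum_congr rfl fun l _ => hall l
      simp only [Pi.add_apply, Finset.sum_add_distrib, Finset.sum_pi_single', Finset.mem_univ,
        if_true, (heven (row p)).1 ⟨_, rfl⟩, (heven (row z)).1 ⟨_, rfl⟩] at h1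
      exact absurd h1 (by decide)
    obtain ⟨l, hl⟩ := hodd
    by_contra hne
    have hl2 : ∃ k, k ≠ l ∧ row p k ≠ (row z + Pi.single i 1 : ι → ZMod 2) k := by
      by_contra! hall
      refine hne ?_
      rw [hammingDist, Finset.card_eq_one]
      refine ⟨l, ?_⟩
      ext k
      simp only [Finset.mem_filter, Finset.mem_univ, true_and, Finset.mem_singleton]
      refine ⟨fun h => ?_, fun h => h ▸ hl⟩
      by_contra hkl
      exact h (hall k hkl)
    obtain ⟨k, hkl, hk⟩ := hl2
    have hout : ∀ k, row p k ≠ (row z + Pi.single i 1 : ι → ZMod 2) k → k ≠ i ∧ k ≠ j ∧ row z k ≠ row p k := by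
      intro k hk
      have hki : k ≠ i := by
        rintro rfl
        refine hk ?_
        simpa [hzi] using (ZMod.add_one_eq_of_ne_two hpi.symm).symm
      have hk' : row p k ≠ row z k := by simpa [hki] using hk
      refine ⟨hki, ?_, hk'.symm⟩
      rintro rfl
      exact hk' ((ZMod.add_one_eq_of_ne_two hpj.symm).symm.trans
        (ZMod.add_one_eq_of_ne_two hzj.symm))
    obtain ⟨hli, hlj, hlz⟩ := hout l hl
    obtain ⟨hki, hkj, hkz⟩ := hout k hk
    have hpz : p ≠ z := by
      rintro rfl
      exact hlz rfl
    have hwz : w ≠ z := by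
      rintro rfl
      exact hzj hwj
    have hwp : w ≠ p := by
      rintro rfl
      exact hpj hwj
    obtain ⟨r, rfl⟩ := Multiset.exists_cons_of_mem hz
    obtain ⟨r, rfl⟩ := Multiset.exists_cons_of_mem ((Multiset.mem_cons.1 hp).resolve_left hpz)
    have hwr : w ∈ r := by simpa [hwz, hwp] using hw
    obtain ⟨z', hz'⟩ := (heven (flipTwo (row z) k l)).2
      (by rw [sum_flipTwo]; exact (heven _).1 ⟨_, rfl⟩)
    obtain ⟨p', hp'⟩ := (heven (flipTwo (row p) k l)).2
      (by rw [sum_flipTwo]; exact (heven _).1 ⟨_, rfl⟩)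
    have hperm : x₀ ::ₘ z ::ₘ p ::ₘ r = z ::ₘ p ::ₘ x₀ ::ₘ r := by
      rw [Multiset.cons_swap x₀ z, Multiset.cons_swap x₀ p]
    rw [hperm] at ha
    have hmem := hA z p z' p' (x₀ ::ₘ r) k l ha hkl hkz hlz hz' hp'
    have h1 := add_single_eq_add_single heven hA hmin hmem (by simp)
      (Multiset.mem_cons_self z' _) (w := w) (by simp [hwr]) hij hi hj
      (by rw [hz', flipTwo_of_ne _ (Ne.symm hki) (Ne.symm hli), hzi]) hwj
    rw [← hzw] at h1
    have h2 := congrFun h1 k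
    simp only [Pi.add_apply, Pi.single_eq_of_ne hki, add_zero, hz', flipTwo_left _ hkl] at h2
    simp at h2

/-- Take `x₀` closest to `y` among all rows occurring in `A`. If it is not `y`, all other rows of
its multiset lie at distance 1 from an odd vector `v`, the least distance possible for an even row,
while `x₀` is strictly closer to `v` than `y` is. So the total distance to `v` is smaller than that
of `t`, contradicting equality of columns. -/
theorem exists_mem_of_isSwapClosed
    (hinj : Function.Injective row) (heven : ∀ v : ι → ZMod 2, (∃ x, row x = v) ↔ ∑ i, v i = 0)
    (hA : IsSwapClosed row A) {t : Multiset σ} (hyt : y ∈ t)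
    (hcol : ∀ a ∈ A, SameColumns row a t) (hne : ∃ a ∈ A, a ≠ 0) : ∃ a ∈ A, y ∈ a := by
  obtain ⟨x₀, ⟨a, ha, hxa⟩, hmin'⟩ : ∃ x ∈ {x | ∃ a ∈ A, x ∈ a}, ∀ x' ∈ {x | ∃ a ∈ A, x ∈ a},
      hammingDist (row x) (row y) ≤ hammingDist (row x') (row y) := by
    obtain ⟨a, ha, ha0⟩ := hne
    obtain ⟨x, hx⟩ := Multiset.exists_mem_of_ne_zero ha0
    obtain ⟨x₀, hx₀, h⟩ := (measure fun x => hammingDist (row x) (row y)).wf.has_min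
      {x | ∃ a ∈ A, x ∈ a} ⟨x, a, ha, hx⟩
    exact ⟨x₀, hx₀, fun x' hx' => not_lt.1 (h x' hx')⟩
  have hmin : ∀ a ∈ A, ∀ x ∈ a, hammingDist (row x₀) (row y) ≤ hammingDist (row x) (row y) :=
    fun a ha x hx => hmin' x ⟨a, ha, hx⟩
  by_cases hxy : row x₀ = row y
  · exact ⟨a, ha, hinj hxy ▸ hxa⟩
  exfalso
  obtain ⟨i, hi⟩ := Function.ne_iff.1 hxy
  -- Two even vectors cannot differ in exactly one place.
  obtain ⟨j, hij, hj⟩ : ∃ j, i ≠ j ∧ row x₀ j ≠ row y j := by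
    by_contra! hall
    have h1 : ∑ k, (row x₀ k - row y k) = row x₀ i - row y i :=
      Finset.sum_eq_single_of_mem i (Finset.mem_univ i) fun k _ hk =>
        sub_eq_zero.2 (hall k hk.symm)
    rw [Finset.sum_sub_distrib, (heven _).1 ⟨_, rfl⟩, (heven _).1 ⟨_, rfl⟩, sub_zero] at h1
    exact hi (sub_eq_zero.1 h1.symm)
  obtain ⟨a, rfl⟩ := Multiset.exists_cons_of_mem hxa
  have hcola := hcol _ ha
  have hex : ∀ k, row x₀ k ≠ row y k → ∃ z ∈ a, row z k = row y k := by
    intro k hk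
    have h1 : 0 < (x₀ ::ₘ a).countP (fun x => row x k = row y k) := by
      rw [hcola k]
      exact Multiset.countP_pos.2 ⟨y, hyt, rfl⟩
    obtain ⟨z, hz, hzk⟩ := Multiset.countP_pos.1 h1
    refine ⟨z, (Multiset.mem_cons.1 hz).resolve_left ?_, hzk⟩
    rintro rfl
    exact hk hzk
  obtain ⟨z, hz, hzi⟩ := hex i hi
  obtain ⟨w, hw, hwj⟩ := hex j hj
  set v : ι → ZMod 2 := row z + Pi.single i 1 with hv
  have hdist : ∀ p ∈ a, hammingDist (row p) v = 1 := fun p hp =>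
    hammingDist_add_single_eq_one heven hA hmin ha hz hw hij hi hj hzi hwj hp
  have hpos : ∀ p : σ, 1 ≤ hammingDist (row p) v := by
    intro p
    rw [Nat.one_le_iff_ne_zero, hammingDist_ne_zero]
    intro h
    have h1 : ∑ l, row p l = ∑ l, v l := by rw [h]
    simp only [hv, Pi.add_apply, Finset.sum_add_distrib, Finset.sum_pi_single', Finset.mem_univ,
      if_true, (heven (row p)).1 ⟨_, rfl⟩, (heven (row z)).1 ⟨_, rfl⟩] at h1
    exact absurd h1 (by decide)
  -- Where `x₀` and `y` differ, `v` disagrees with `y` and so agrees with `x₀`; elsewhere `x₀` and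
  -- `y` coincide.
  have hlt : hammingDist (row x₀) v < hammingDist (row y) v := by
    have hvT : ∀ k, row x₀ k ≠ row y k → v k ≠ row y k := by
      intro k hk
      by_cases hki : k = i
      · subst hki
        simp [hv, hzi]
      · simpa [hv, hki] using not_two_agreements heven hA hmin ha hxa
          (Multiset.mem_cons_of_mem hz) (Ne.symm hki) hi hk hzi
    refine Finset.card_lt_card ((Finset.ssubset_iff_of_subset ?_).2 ⟨i, ?_, ?_⟩)
    · intro k
      simp only [Finset.mem_filter, Finset.mem_univ, true_and]
      intro hk
      by_cases hxk : row x₀ k = row y k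
      · rwa [← hxk]
      · exact (hvT k hxk).symm
    · simpa using (hvT i hi).symm
    · simp only [Finset.mem_filter, Finset.mem_univ, true_and, not_not]
      exact (ZMod.add_one_eq_of_ne_two hi.symm).symm.trans
        (ZMod.add_one_eq_of_ne_two (hvT i hi).symm)
  obtain ⟨t, rfl⟩ := Multiset.exists_cons_of_mem hyt
  have : Nonempty ι := ⟨i⟩
  have hcard := hcola.card_eq
  have hsum := hcola.sum_hammingDist_eq v
  simp only [Multiset.map_cons, Multiset.sum_cons, Multiset.card_cons] at hcard hsum
  have h1 : (a.map fun x => hammingDist (row x) v).sum = a.card := by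
    rw [Multiset.map_congr rfl hdist]
    simp
  have h2 : t.card ≤ (t.map fun x => hammingDist (row x) v).sum := by
    have := Multiset.card_nsmul_le_sum (s := t.map fun x => hammingDist (row x) v) (a := 1)
      (by
        intro n hn
        obtain ⟨p, -, rfl⟩ := Multiset.mem_map.1 hn
        exact hpos p)
    simpa using this
  omega

/-- The binomials of degree two generate all the binomials of the ideal. -/
theorem multisetMonomial_sub_mem_of_sameColumns {K : Type*} [Field K] [Nonempty ι]
    (hinj : Function.Injective row) (heven : ∀ v : ι → ZMod 2, (∃ x, row x = v) ↔ ∑ i, v i = 0)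
    {J : Ideal (MvPolynomial σ K)}
    (hJ : ∀ s t : Multiset σ, s.card = 2 → t.card = 2 → SameColumns row s t →
      multisetMonomial K s - multisetMonomial K t ∈ J)
    (s t : Multiset σ) (h : SameColumns row s t) :
    multisetMonomial K s - multisetMonomial K t ∈ J := by
  induction t using Multiset.induction generalizing s with
  | empty =>
    have : s = 0 := by simpa using h.card_eq
    simp [this]
  | cons y t ih =>
    -- The multisets congruent to `s` modulo `J` with the right columns; exchanges preserve this
    -- since their quadrics lie in `J`.
    let A : Set (Multiset σ) :=
      {a | multisetMonomial K s - multisetMonomial K a ∈ J ∧ SameColumns row a (y ::ₘ t)}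
    have hA : IsSwapClosed row A := by
      rintro x z x' z' r i j ⟨h1, h2⟩ hij hi hj hx hz
      have hsc := sameColumns_flipTwo hij hi hj hx hz
      have hadd : ∀ p q : σ, p ::ₘ q ::ₘ r = {p, q} + r := fun p q => by
        rw [Multiset.insert_eq_cons, Multiset.cons_add, Multiset.singleton_add]
      rw [hadd] at h1 h2
      have h3 := J.mul_mem_right (multisetMonomial K r)
        (hJ {x, z} {x', z'} (by simp) (by simp) hsc)
      rw [sub_mul, ← multisetMonomial_add, ← multisetMonomial_add] at h3
      refine ⟨?_, ?_⟩
      · rw [hadd]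
        simpa using J.add_mem h1 h3
      · rw [hadd]
        exact (hsc.add_right r).symm.trans h2
    obtain ⟨a, ⟨ha1, ha2⟩, hya⟩ := exists_mem_of_isSwapClosed hinj heven hA
      (Multiset.mem_cons_self y t) (fun a ha => ha.2) ⟨s, ⟨by simp, h⟩, by
        rintro rfl
        simpa using h.card_eq⟩
    obtain ⟨a, rfl⟩ := Multiset.exists_cons_of_mem hya
    have h4 := J.mul_mem_left (multisetMonomial K {y}) (ih a ha2.of_cons)
    rw [mul_sub, ← multisetMonomial_add, ← multisetMonomial_add, Multiset.singleton_add,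
      Multiset.singleton_add] at h4
    simpa using J.add_mem ha1 h4

end Connectivity

/-! ### Closed forms of Stirling numbers. -/

theorem Nat.stirlingSecond_two_right (n : ℕ) :
    (stirlingSecond (n + 1) 2 : ℤ) = 2 ^ n - 1 := by
  induction n with
  | zero => rfl
  | succ n ih =>
    rw [stirlingSecond_succ_succ, stirlingSecond_one_right]
    push_cast
    rw [ih]
    ring

theorem Nat.two_mul_stirlingSecond_three_right (n : ℕ) :
    (2 * stirlingSecond (n + 1) 3 : ℤ) = 3 ^ n - 2 * 2 ^ n + 1 := by
  induction n with
  | zero => rfl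
  | succ n ih =>
    rw [stirlingSecond_succ_succ]
    push_cast
    rw [stirlingSecond_two_right]
    linear_combination 3 * ih

theorem Nat.six_mul_stirlingSecond_four_right (n : ℕ) :
    (6 * stirlingSecond (n + 1) 4 : ℤ) = 4 ^ n - 3 * 3 ^ n + 3 * 2 ^ n - 1 := by
  induction n with
  | zero => rfl
  | succ n ih =>
    rw [stirlingSecond_succ_succ]
    push_cast
    linear_combination 4 * ih + 3 * two_mul_stirlingSecond_three_right n

/-! ### Counting even vectors and column sums of pairs. -/

section Count

variable {ι : Type*} [Fintype ι] [DecidableEq ι]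

theorem two_mul_card_sum_eq_zero [Nonempty ι] :
    2 * (Finset.univ.filter fun v : ι → ZMod 2 => ∑ i, v i = 0).card = 2 ^ Fintype.card ι := by
  obtain ⟨i⟩ := ‹Nonempty ι›
  have hflip : ∀ v : ι → ZMod 2, ∑ k, (v + Pi.single i 1 : ι → ZMod 2) k = ∑ k, v k + 1 := by
    intro v
    simp [Finset.sum_add_distrib]
  have hinv : ∀ v : ι → ZMod 2, v + Pi.single i 1 + Pi.single i 1 = v := fun v => by
    rw [add_assoc, CharTwo.add_self_eq_zero, add_zero]
  have h1 : (Finset.univ.filter fun v : ι → ZMod 2 => ∑ i, v i = 0).card =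
      (Finset.univ.filter fun v : ι → ZMod 2 => ¬ ∑ i, v i = 0).card := by
    refine Finset.card_nbij' (fun v => v + Pi.single i 1) (fun v => v + Pi.single i 1) ?_ ?_
      (fun v _ => hinv v) (fun v _ => hinv v)
    · intro v
      simp only [Finset.coe_filter, Finset.mem_univ, true_and, Set.mem_ofPred_eq, hflip]
      intro h
      rw [h]
      decide
    · intro v
      simp only [Finset.coe_filter, Finset.mem_univ, true_and, Set.mem_ofPred_eq, hflip]
      generalize ∑ k, v k = c
      revert c
      decide
  have h2 := Finset.card_filter_add_card_filter_not (s := Finset.univ)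
    (fun v : ι → ZMod 2 => ∑ i, v i = 0)
  rw [← h1, ← two_mul, Finset.card_univ, Fintype.card_fun, ZMod.card] at h2
  exact h2

/-- The possible column sums of two binary vectors with even sum. -/
def pairColumnSums (ι : Type*) [Fintype ι] [DecidableEq ι] : Finset (ι → ℕ) :=
  (Fintype.piFinset fun _ : ι => Finset.range 3).filter fun v =>
    Even (∑ i, v i) ∧ ((∀ i, v i ≠ 1) → 4 ∣ ∑ i, v i)

/-- Twice the indicator is a signed sum of four product functions. Each sums over `{0,1,2}^ι` to a
power, with bases 3, 1, 2 and 0; the last vanishes because `ι` is nonempty. -/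
theorem two_mul_card_pairColumnSums [Nonempty ι] :
    (2 * (pairColumnSums ι).card : ℤ) = 3 ^ Fintype.card ι + 1 - 2 ^ Fintype.card ι := by
  have hprod : ∀ f : ℕ → ℤ, ∑ v ∈ Fintype.piFinset fun _ : ι => Finset.range 3, ∏ i, f (v i) =
      (f 0 + f 1 + f 2) ^ Fintype.card ι := by
    intro f
    rw [← Finset.prod_univ_sum (fun _ : ι => Finset.range 3) (fun _ n => f n)]
    simp [Finset.sum_range_succ]
  have h2 := hprod fun n => (-1) ^ n
  have h3 := hprod fun n => if n = 1 then 0 else 1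
  have h4 := hprod fun n => if n = 1 then 0 else (-1) ^ (n / 2)
  norm_num at h2 h3 h4
  have key : (2 * (pairColumnSums ι).card : ℤ) =
      ∑ v ∈ Fintype.piFinset fun _ : ι => Finset.range 3, ((1 : ℤ) + (∏ i, (-1) ^ (v i)) -
        (∏ i, if v i = 1 then 0 else 1) + ∏ i, if v i = 1 then 0 else (-1) ^ (v i / 2)) := by
    rw [pairColumnSums, Finset.card_filter, Nat.cast_sum, Finset.mul_sum]
    refine Finset.sum_congr rfl fun v hv => ?_
    rw [Finset.prod_pow_eq_pow_sum]
    by_cases h : ∃ i, v i = 1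
    · obtain ⟨i, hi⟩ := h
      rw [Finset.prod_eq_zero (Finset.mem_univ i) (by simp [hi]),
        Finset.prod_eq_zero (Finset.mem_univ i) (by simp [hi])]
      have : ¬ ∀ i, v i ≠ 1 := fun h => h i hi
      rcases Nat.even_or_odd (∑ i, v i) with he | ho
      · simp [he, this]
      · simp [Nat.not_even_iff_odd.2 ho, ho.neg_one_pow]
    · push Not at h
      have hsum : ∑ i, v i = 2 * ∑ i, v i / 2 := by
        rw [Finset.mul_sum]
        refine Finset.sum_congr rfl fun i _ => ?_
        have h3 := Finset.mem_range.1 (Fintype.mem_piFinset.1 hv i)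
        have := h i
        omega
      simp only [h, if_false, Finset.prod_const_one]
      have hev : Even (∑ i, v i) := ⟨∑ i, v i / 2, by rw [hsum]; ring⟩
      rw [Finset.prod_pow_eq_pow_sum]
      rcases Nat.even_or_odd (∑ i, v i / 2) with he | ho
      · have h4 : 4 ∣ ∑ i, v i := by
          have := he.two_dvd
          omega
        simp [h4, hev, he]
      · have h4 : ¬ 4 ∣ ∑ i, v i := by
          obtain ⟨k, hk⟩ := ho
          omega
        simp [h, h4, hev, ho]
  rw [key, Finset.sum_add_distrib, Finset.sum_sub_distrib, Finset.sum_add_distrib, h2, h3, h4]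
  simp

end Count

/-! ### Fibres of the degree 2 monomials. -/

section Quadrics

variable {σ ι : Type*} {row : σ → ι → ZMod 2}

/-- The column sums of a multiset of binary vectors. -/
def columnSums (row : σ → ι → ZMod 2) (s : Multiset σ) (i : ι) : ℕ :=
  s.countP fun x => row x i = 1

theorem sameColumns_iff_columnSums_eq {s t : Multiset σ} (h : s.card = t.card) :
    SameColumns row s t ↔ columnSums row s = columnSums row t := by
  refine ⟨fun H => funext fun i => H i 1, fun H i b => ?_⟩
  have h1 : s.countP (fun x => row x i = 1) = t.countP (fun x => row x i = 1) := congrFun H i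
  by_cases hb : b = 1
  · rw [hb, h1]
  have h0 : b = 0 := by
    revert b
    decide
  have hnot : ∀ s : Multiset σ, s.countP (fun x => row x i = 0) =
      s.countP (fun x => ¬ row x i = 1) := fun s =>
    Multiset.countP_congr rfl fun x _ => by
      generalize row x i = c
      revert c
      decide
  have h2 := Multiset.card_eq_countP_add_countP (fun x => row x i = 1) s
  have h3 := Multiset.card_eq_countP_add_countP (fun x => row x i = 1) t
  rw [h0, hnot s, hnot t]
  omega

variable [Fintype ι] [DecidableEq ι]

/-- If no column sum is 1, the two rows are equal, so the total is twice an even number; this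
explains the divisibility by 4. Conversely, a column with sum 1 leaves one bit free to correct the
parity. -/
theorem range_columnSums [Fintype σ] [DecidableEq σ]
    (heven : ∀ v : ι → ZMod 2, (∃ x, row x = v) ↔ ∑ i, v i = 0) :
    (Finset.univ.image fun p : Sym σ 2 => columnSums row p) = pairColumnSums ι := by
  have hval : ∀ x z : σ, columnSums row ({x, z} : Multiset σ) =
      fun i => (row x i).val + (row z i).val := by
    intro x z
    funext i
    have hpair : ({x, z} : Multiset σ) = x ::ₘ z ::ₘ 0 := rfl
    rw [columnSums, hpair, Multiset.countP_cons, Multiset.countP_cons, Multiset.countP_zero]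
    generalize row x i = b
    generalize row z i = c
    revert b c
    decide
  have heven' : ∀ x : σ, 2 ∣ ∑ i, (row x i).val := by
    intro x
    rw [← ZMod.natCast_eq_zero_iff, Nat.cast_sum]
    simpa using (heven (row x)).1 ⟨x, rfl⟩
  ext v
  simp only [Finset.mem_image, Finset.mem_univ, true_and, pairColumnSums, Finset.mem_filter,
    Fintype.mem_piFinset, Finset.mem_range]
  constructor
  · rintro ⟨⟨p, hp⟩, rfl⟩
    obtain ⟨x, z, rfl⟩ := Multiset.card_eq_two.1 hp
    simp only [Sym.coe_mk, hval]
    have hx := heven' x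
    have hz := heven' z
    refine ⟨fun i => ?_, ?_, fun h => ?_⟩
    · have := ZMod.val_lt (row x i)
      have := ZMod.val_lt (row z i)
      omega
    · rw [Finset.sum_add_distrib, even_iff_two_dvd]
      omega
    · have : ∑ i, (row z i).val = ∑ i, (row x i).val := by
        refine Finset.sum_congr rfl fun i _ => ?_
        have h1 := h i
        revert h1
        generalize row x i = b
        generalize row z i = c
        revert b c
        decide
      rw [Finset.sum_add_distrib, this]
      omega
  · rintro ⟨hlt, hev, h4⟩
    have hx : ∃ x : ι → ZMod 2, (∀ i, v i ≠ 1 → x i = (v i / 2 : ℕ)) ∧ ∑ i, x i = 0 := by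
      by_cases h : ∃ i, v i = 1
      · obtain ⟨i, hi⟩ := h
        refine ⟨(fun k => ((v k / 2 : ℕ) : ZMod 2)) +
          Pi.single i (-∑ k, ((v k / 2 : ℕ) : ZMod 2)), fun k hk => ?_, ?_⟩
        · have hki : k ≠ i := by
            rintro rfl
            exact hk hi
          simp [hki]
        · simp [Finset.sum_add_distrib, CharTwo.add_self_eq_zero]
      · push Not at h
        refine ⟨fun k => ((v k / 2 : ℕ) : ZMod 2), fun _ _ => rfl, ?_⟩
        rw [← Nat.cast_sum, ZMod.natCast_eq_zero_iff]
        have hsum : ∑ i, v i = 2 * ∑ i, v i / 2 := by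
          rw [Finset.mul_sum]
          refine Finset.sum_congr rfl fun i _ => ?_
          have := h i
          have := hlt i
          omega
        have := h4 h
        omega
    obtain ⟨x, hx1, hx0⟩ := hx
    obtain ⟨p, hp⟩ := (heven x).2 hx0
    -- The second row differs from `x` exactly where the column sum is 1.
    obtain ⟨q, hq⟩ := (heven fun i => x i + (v i : ZMod 2)).2 (by
      rw [Finset.sum_add_distrib, hx0, zero_add, ← Nat.cast_sum, ZMod.natCast_eq_zero_iff]
      exact hev.two_dvd)
    refine ⟨⟨{p, q}, by simp⟩, ?_⟩
    rw [Sym.coe_mk, hval, hp, hq]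
    funext i
    have hdec : ∀ (n : ℕ) (b : ZMod 2), n < 3 → (n ≠ 1 → b = (n / 2 : ℕ)) →
        b.val + (b + (n : ZMod 2)).val = n := by
      intro n b hn
      interval_cases n <;> revert b <;> decide
    exact hdec (v i) (x i) (hlt i) (hx1 i)

theorem card_rows [Nonempty ι] [Fintype σ] (hinj : Function.Injective row)
    (heven : ∀ v : ι → ZMod 2, (∃ x, row x = v) ↔ ∑ i, v i = 0) :
    2 * Fintype.card σ = 2 ^ Fintype.card ι := by
  rw [← two_mul_card_sum_eq_zero, ← Finset.card_univ, ← Finset.card_image_of_injective _ hinj]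
  congr 2
  ext v
  simp [heven]

end Quadrics

/-! ### Differences with fibre representatives. -/

section Representatives

variable {α β : Type*} [Nonempty α] (F : α → β)

/-- A chosen element of the fibre of `F` through `p`. -/
noncomputable def fibreRep (p : α) : α := Function.invFun F (F p)

theorem apply_fibreRep (p : α) : F (fibreRep F p) = F p := Function.invFun_eq ⟨p, rfl⟩

theorem fibreRep_congr {p q : α} (h : F p = F q) : fibreRep F p = fibreRep F q := by
  rw [fibreRep, h, fibreRep]

theorem card_fibreRep_ne [Fintype α] [DecidableEq α] [DecidableEq β] :
    (Finset.univ.filter fun p => fibreRep F p ≠ p).card + (Finset.univ.image F).card =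
      Fintype.card α := by
  have h1 : (Finset.univ.filter fun p => fibreRep F p = p).card = (Finset.univ.image F).card := by
    refine Finset.card_nbij F (by simp [Set.MapsTo]) ?_ ?_
    · intro p hp q hq h
      simp only [Finset.coe_filter, Finset.mem_univ, true_and, Set.mem_ofPred_eq] at hp hq
      rw [← hp, ← hq, fibreRep_congr F h]
    · intro b hb
      obtain ⟨p, -, rfl⟩ := Finset.mem_image.1 hb
      exact ⟨fibreRep F p, by simpa using fibreRep_congr F (apply_fibreRep F p), apply_fibreRep F p⟩
  rw [← h1, add_comm]
  exact Finset.card_filter_add_card_filter_not _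

/-- For a non-representative `p`, the vector `v p` occurs only in the difference indexed by `p`, so
the coordinate functionals at such `p` form a dual family. -/
theorem linearIndepOn_sub_fibreRep {K M : Type*} [Field K] [AddCommGroup M] [Module K M]
    {v : α → M} (hv : LinearIndependent K v) :
    LinearIndepOn K (fun p => v p - v (fibreRep F p)) {p | fibreRep F p ≠ p} := by
  have hext : ∀ p : α, ∃ f : Module.Dual K M, ∀ q, f (v q) = Finsupp.single q (1 : K) p := by
    intro p
    obtain ⟨g, hg⟩ := LinearMap.exists_leftInverse_of_injective
      (Finsupp.linearCombination K v) (LinearMap.ker_eq_bot.2 hv)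
    refine ⟨Finsupp.lapply p ∘ₗ g, fun q => ?_⟩
    have := LinearMap.congr_fun hg (Finsupp.single q 1)
    simp only [LinearMap.comp_apply, Finsupp.linearCombination_single, one_smul,
      LinearMap.id_apply] at this
    simp [this]
  choose f hf using hext
  have hrep : ∀ p : {p | fibreRep F p ≠ p}, ∀ q, fibreRep F q ≠ p := by
    rintro ⟨p, hp⟩ q rfl
    exact hp (fibreRep_congr F (apply_fibreRep F q))
  refine LinearIndependent.of_pairwise_dual_eq_zero_one _ (fun p => f p) ?_ ?_
  · intro p q hpq
    simp only [map_sub, hf]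
    rw [Finsupp.single_eq_of_ne (Subtype.coe_ne_coe.2 hpq), Finsupp.single_eq_of_ne (hrep p q).symm,
      sub_zero]
  · intro p
    simp only [map_sub, hf]
    rw [Finsupp.single_eq_same, Finsupp.single_eq_of_ne (hrep p p).symm, sub_zero]

end Representatives

/-! ### The basis of quadratic binomials and its size. -/

namespace MvPolynomial

variable {σ τ ι K : Type*} [Field K] [Fintype ι] [Nonempty ι] [DecidableEq ι] {row : σ → ι → ZMod 2}

theorem exists_quadraticBinomial_basis [Finite σ] (hinj : Function.Injective row)
    (heven : ∀ v : ι → ZMod 2, (∃ x, row x = v) ↔ ∑ i, v i = 0)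
    {φ : MvPolynomial σ K →ₐ[K] MvPolynomial τ K} {u : σ → τ →₀ ℕ}
    (hφ : ∀ x, φ (X x) = monomial (u x) 1)
    (hu : ∀ s t : Multiset σ, (s.map u).sum = (t.map u).sum ↔ SameColumns row s t) :
    ∃ B : Set (MvPolynomial σ K), (∀ f ∈ B, f.IsQuadraticBinomial) ∧ LinearIndepOn K id B ∧
      Ideal.span B = RingHom.ker φ ∧
      B.encard = ((3 * Nat.stirlingSecond (Fintype.card ι) 4 : ℕ) : ℕ∞) := by
  classical
  obtain ⟨_⟩ := nonempty_fintype σ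
  obtain ⟨x₀, -⟩ := (heven 0).2 (by simp)
  have : Nonempty (Sym σ 2) := ⟨⟨{x₀, x₀}, by simp⟩⟩
  let F : Sym σ 2 → ι → ℕ := fun p => columnSums row p
  let q : Sym σ 2 → MvPolynomial σ K := fun p => multisetMonomial K p
  have hq : q = (basisMonomials σ K) ∘ fun p : Sym σ 2 => Multiset.toFinsupp (p : Multiset σ) := by
    funext p
    simp only [q, Function.comp_apply, coe_basisMonomials, multisetMonomial_eq_monomial]
  have hinjF : Function.Injective fun p : Sym σ 2 => Multiset.toFinsupp (p : Multiset σ) :=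
    fun p p' h => Sym.coe_injective (Multiset.toFinsupp.injective h)
  have hqli : LinearIndependent K q := by
    rw [hq]
    exact (basisMonomials σ K).linearIndependent.comp _ hinjF
  have hcard : ∀ p : Sym σ 2, Multiset.card (p : Multiset σ) = 2 := fun p => p.2
  have hli := linearIndepOn_sub_fibreRep F hqli
  have hcol : ∀ p p' : Sym σ 2, SameColumns row (p : Multiset σ) p' ↔ F p = F p' := fun p p' =>
    sameColumns_iff_columnSums_eq (by rw [hcard, hcard])
  have hφm : ∀ s : Multiset σ, φ (multisetMonomial K s) = monomial (s.map u).sum 1 := by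
    intro s
    induction s using Multiset.induction with
    | empty => simp [multisetMonomial]
    | cons x s ih =>
      rw [← Multiset.singleton_add, multisetMonomial_add, map_mul, ih]
      simp [multisetMonomial, hφ, monomial_mul]
  refine ⟨(fun p => q p - q (fibreRep F p)) '' {p | fibreRep F p ≠ p}, ?_, hli.id_image,
    le_antisymm ?_ ?_, ?_⟩
  · rintro _ ⟨p, hp, rfl⟩
    refine ⟨Multiset.toFinsupp (p : Multiset σ), Multiset.toFinsupp ((fibreRep F p : Sym σ 2) : Multiset σ),
      fun h => hp (hinjF h).symm, ?_, ?_, ?_⟩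
    · exact (Multiset.toFinsupp_sum_eq _).trans (hcard _)
    · exact (Multiset.toFinsupp_sum_eq _).trans (hcard _)
    · simp only [q, multisetMonomial_eq_monomial]
  · refine Ideal.span_le.2 ?_
    rintro _ ⟨p, -, rfl⟩
    rw [SetLike.mem_coe, RingHom.mem_ker, map_sub, hφm, hφm,
      (hu p ((fibreRep F p : Sym σ 2) : Multiset σ)).2 ((hcol _ _).2 (apply_fibreRep F p).symm), sub_self]
  · refine ker_le_of_multisetMonomial_sub_mem hφ fun s t hst =>
      multisetMonomial_sub_mem_of_sameColumns hinj heven ?_ s t ((hu s t).1 hst)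
    intro s t hs ht hst
    have hmem : ∀ p : Sym σ 2, q p - q (fibreRep F p) ∈
        Ideal.span ((fun p => q p - q (fibreRep F p)) '' {p | fibreRep F p ≠ p}) := by
      intro p
      by_cases hp : fibreRep F p = p
      · rw [hp, sub_self]
        exact zero_mem _
      · exact Ideal.subset_span ⟨p, hp, rfl⟩
    have h1 := hmem ⟨s, hs⟩
    rw [fibreRep_congr F ((hcol ⟨s, hs⟩ ⟨t, ht⟩).1 hst)] at h1
    have h2 := sub_mem h1 (hmem ⟨t, ht⟩)
    rwa [sub_sub_sub_cancel_right] at h2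
  · rw [hli.injOn.encard_image, ← Finset.coe_filter_univ, Set.encard_coe_eq_coe_finsetCard]
    congr 1
    -- The size is the number of degree 2 monomials in `2^n` variables minus the number of possible
    -- column sums.
    have h1 := card_fibreRep_ne F
    rw [range_columnSums heven, Sym.card_sym_eq_choose] at h1
    have h2 := card_rows hinj heven
    have h3 := two_mul_card_pairColumnSums (ι := ι)
    obtain ⟨n, hn⟩ : ∃ n, Fintype.card ι = n + 1 :=
      Nat.exists_eq_succ_of_ne_zero Fintype.card_ne_zero
    have h4 := Nat.six_mul_stirlingSecond_four_right n
    rw [hn] at h2 h3 ⊢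
    have h5 : Fintype.card σ = 2 ^ n := by
      rw [pow_succ] at h2
      omega
    have h6 := Nat.add_one_mul_choose_eq (Fintype.card σ) 1
    rw [Nat.choose_one_right] at h6
    rw [show Fintype.card σ + 2 - 1 = Fintype.card σ + 1 by omega] at h1
    have h7 : (4 : ℤ) ^ n = 2 ^ n * 2 ^ n := by rw [← mul_pow]; norm_num
    zify at h1 h5 h6 ⊢
    rw [h5] at h6
    rw [pow_succ, pow_succ] at h3
    linarith

end MvPolynomial

/-! ### Cut vectors of graphs and cycles. -/

namespace SimpleGraph

section Cut

variable {V : Type*} (G : SimpleGraph V)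

theorem mem_cutSet_iff {P : UnorderedSplit V} {A : Set V} (hP : P.1 = s(A, Aᶜ)) {i j : V}
    (h : G.Adj i j) : s(i, j) ∈ G.cutSet P ↔ ¬ (i ∈ A ↔ j ∈ A) := by
  simp only [cutSet, Set.mem_ofPred_eq, mem_edgeSet, h, true_and, hP]
  constructor
  · rintro ⟨B, C, hBC, k, hk, l, hl, hkl⟩
    rw [Sym2.eq_iff] at hBC hkl
    rcases hBC with ⟨rfl, rfl⟩ | ⟨rfl, rfl⟩ <;> rcases hkl with ⟨rfl, rfl⟩ | ⟨rfl, rfl⟩ <;>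
      simp_all
  · intro hij
    by_cases hi : i ∈ A
    · exact ⟨A, Aᶜ, rfl, i, hi, j, fun hj => hij (iff_of_true hi hj), rfl⟩
    · exact ⟨A, Aᶜ, rfl, j, by_contra fun hj => hij (iff_of_false hi hj), i, hi, Sym2.eq_swap⟩

open scoped Classical in
/-- The exponent of the monomial to which `cutMap` maps the variable of `P`. -/
noncomputable def cutExponent [Fintype G.edgeSet] (P : UnorderedSplit V) :
    G.edgeSet ⊕ G.edgeSet →₀ ℕ :=
  ∑ e : G.edgeSet, Finsupp.single (if (e : Sym2 V) ∈ G.cutSet P then Sum.inl e else Sum.inr e) 1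

theorem cutMap_X (K : Type*) [Field K] [Fintype G.edgeSet] (P : UnorderedSplit V) :
    G.cutMap K (X P) = monomial (G.cutExponent P) 1 := by
  rw [cutMap, aeval_X, cutExponent, monomial_sum_one]
  refine Finset.prod_congr rfl fun e _ => ?_
  split_ifs <;> rfl

theorem cutExponent_inl [Fintype G.edgeSet] (P : UnorderedSplit V) (e : G.edgeSet)
    [Decidable ((e : Sym2 V) ∈ G.cutSet P)] :
    G.cutExponent P (Sum.inl e) = if (e : Sym2 V) ∈ G.cutSet P then 1 else 0 := by
  classical
  rw [cutExponent, Finsupp.finsetSum_apply, Finset.sum_eq_single_of_mem e (Finset.mem_univ e)]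
  · split_ifs <;> simp
  · intro f _ hf
    split_ifs <;> simp [hf]

theorem cutExponent_inr [Fintype G.edgeSet] (P : UnorderedSplit V) (e : G.edgeSet)
    [Decidable ((e : Sym2 V) ∈ G.cutSet P)] :
    G.cutExponent P (Sum.inr e) = if (e : Sym2 V) ∈ G.cutSet P then 0 else 1 := by
  classical
  rw [cutExponent, Finsupp.finsetSum_apply, Finset.sum_eq_single_of_mem e (Finset.mem_univ e)]
  · split_ifs <;> simp
  · intro f _ hf
    split_ifs <;> simp [hf]

theorem sum_cutExponent_eq_iff [Fintype G.edgeSet] {s t : Multiset (UnorderedSplit V)}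
    [∀ (e : G.edgeSet) (P : UnorderedSplit V), Decidable ((e : Sym2 V) ∈ G.cutSet P)] :
    (s.map G.cutExponent).sum = (t.map G.cutExponent).sum ↔ ∀ e : G.edgeSet,
      s.countP (fun P => (e : Sym2 V) ∈ G.cutSet P) =
        t.countP (fun P => (e : Sym2 V) ∈ G.cutSet P) ∧
      s.countP (fun P => (e : Sym2 V) ∉ G.cutSet P) =
        t.countP (fun P => (e : Sym2 V) ∉ G.cutSet P) := by
  have hl : ∀ (s : Multiset (UnorderedSplit V)) (e : G.edgeSet),
      (s.map G.cutExponent).sum (Sum.inl e) = s.countP (fun P => (e : Sym2 V) ∈ G.cutSet P) := by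
    intro s e
    induction s using Multiset.induction with
    | empty => simp
    | cons P s ih =>
      rw [Multiset.map_cons, Multiset.sum_cons, Finsupp.add_apply, ih, Multiset.countP_cons,
        cutExponent_inl, add_comm]
  have hr : ∀ (s : Multiset (UnorderedSplit V)) (e : G.edgeSet),
      (s.map G.cutExponent).sum (Sum.inr e) = s.countP (fun P => (e : Sym2 V) ∉ G.cutSet P) := by
    intro s e
    induction s using Multiset.induction with
    | empty => simp
    | cons P s ih =>
      rw [Multiset.map_cons, Multiset.sum_cons, Finsupp.add_apply, ih, Multiset.countP_cons,
        cutExponent_inr, add_comm]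
      simp
  rw [Finsupp.ext_iff, Sum.forall, ← forall_and]
  simp only [hl, hr]

end Cut

section Cycle

variable {n : ℕ}

theorem cycleGraph_adj_add_one (i : Fin (n + 2)) : (cycleGraph (n + 2)).Adj i (i + 1) := by
  rw [cycleGraph_adj]
  right
  abel

theorem exists_eq_of_mem_edgeSet_cycleGraph {e : Sym2 (Fin (n + 2))}
    (he : e ∈ (cycleGraph (n + 2)).edgeSet) : ∃ i, e = s(i, i + 1) := by
  induction e using Sym2.ind with
  | _ a b =>
    rw [mem_edgeSet, cycleGraph_adj, sub_eq_iff_eq_add', sub_eq_iff_eq_add'] at he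
    rcases he with rfl | rfl
    · exact ⟨b, Sym2.eq_swap⟩
    · exact ⟨a, rfl⟩

open scoped Classical in
/-- The indicator vector of the edges `s(i, i + 1)` of the cycle that are cut by `P`. -/
noncomputable def cycleCutRow (P : UnorderedSplit (Fin (n + 2))) (i : Fin (n + 2)) : ZMod 2 :=
  if s(i, i + 1) ∈ (cycleGraph (n + 2)).cutSet P then 1 else 0

open scoped Classical in
-- The cut vector is the coboundary of the indicator of `A`: its sum telescopes around the cycle,
-- and it determines `A` up to complement.
theorem cycleCutRow_eq {P : UnorderedSplit (Fin (n + 2))} {A : Set (Fin (n + 2))}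
    (hP : P.1 = s(A, Aᶜ)) (i : Fin (n + 2)) :
    cycleCutRow P i = (if i + 1 ∈ A then 1 else 0) - if i ∈ A then 1 else 0 := by
  rw [cycleCutRow, mem_cutSet_iff _ hP (cycleGraph_adj_add_one i)]
  by_cases h : i ∈ A <;> by_cases h' : i + 1 ∈ A <;> simp [h, h']

theorem cycleCutRow_injective :
    Function.Injective (cycleCutRow : UnorderedSplit (Fin (n + 2)) → _) := by
  classical
  intro P Q h
  obtain ⟨A, hA⟩ := P.2
  obtain ⟨B, hB⟩ := Q.2
  have hstep : ∀ i, (i + 1 ∈ A ↔ i + 1 ∈ B) ↔ (i ∈ A ↔ i ∈ B) := by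
    intro i
    have h1 := congrFun h i
    rw [cycleCutRow_eq hA, cycleCutRow_eq hB] at h1
    by_cases ha : i ∈ A <;> by_cases ha' : i + 1 ∈ A <;> by_cases hb : i ∈ B <;>
      by_cases hb' : i + 1 ∈ B <;> simp [ha, ha', hb, hb'] at h1 ⊢
  have hall : ∀ i, (i ∈ A ↔ i ∈ B) ↔ ((0 : Fin (n + 2)) ∈ A ↔ (0 : Fin (n + 2)) ∈ B) := by
    intro i
    induction i using Fin.induction with
    | zero => rfl
    | succ i ih => rw [← ih, ← hstep i.castSucc, Fin.coeSucc_eq_succ]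
  refine Subtype.ext ?_
  rw [hA, hB, Sym2.eq_iff]
  by_cases h0 : (0 : Fin (n + 2)) ∈ A ↔ (0 : Fin (n + 2)) ∈ B
  · have hAB : A = B := Set.ext fun i => (hall i).2 h0
    exact Or.inl ⟨hAB, by rw [hAB]⟩
  · have hAB : A = Bᶜ := Set.ext fun i => by
      have h1 := mt (hall i).1 h0
      rw [Set.mem_compl_iff]
      tauto
    exact Or.inr ⟨hAB, by rw [hAB, compl_compl]⟩

theorem exists_cycleCutRow_eq_iff (v : Fin (n + 2) → ZMod 2) :
    (∃ P, cycleCutRow P = v) ↔ ∑ i, v i = 0 := by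
  classical
  constructor
  · rintro ⟨P, rfl⟩
    obtain ⟨A, hA⟩ := P.2
    rw [Finset.sum_congr rfl fun i _ => cycleCutRow_eq hA i, Finset.sum_sub_distrib, sub_eq_zero]
    exact Equiv.sum_comp (Equiv.addRight (1 : Fin (n + 2))) fun i =>
      if i ∈ A then (1 : ZMod 2) else 0
  · intro hv
    -- Partial sums integrate `v` starting from 0; the vanishing total is what closes the cycle at
    -- the last index.
    let c : Fin (n + 2) → ZMod 2 := fun i => ∑ j ∈ Finset.univ.filter (· < i), v j
    have hc : ∀ i, c (i + 1) - c i = v i := by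
      intro i
      induction i using Fin.lastCases with
      | last =>
        have h1 : c (Fin.last (n + 1)) + v (Fin.last (n + 1)) = 0 := by
          rw [← hv, ← Finset.sum_erase_add _ _ (Finset.mem_univ (Fin.last (n + 1)))]
          refine congrArg (· + _) (Finset.sum_congr ?_ fun _ _ => rfl)
          ext j
          simp [Fin.lt_last_iff_ne_last]
        have h2 : c (Fin.last (n + 1) + 1) = 0 := by simp [c]
        rw [h2, zero_sub]
        exact (eq_neg_of_add_eq_zero_right h1).symm
      | cast i =>
        rw [Fin.coeSucc_eq_succ, sub_eq_iff_eq_add]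
        have h1 : Finset.univ.filter (· < i.succ) =
            insert i.castSucc (Finset.univ.filter (· < i.castSucc)) := by
          ext j
          simp only [Finset.mem_filter, Finset.mem_univ, true_and, Finset.mem_insert]
          rw [← Fin.le_castSucc_iff, le_iff_eq_or_lt]
        simp only [c, h1]
        rw [Finset.sum_insert (by simp)]
    obtain ⟨P, hP⟩ : ∃ P : UnorderedSplit (Fin (n + 2)), P.1 = s({i | c i = 1}, {i | c i = 1}ᶜ) :=
      ⟨⟨_, _, rfl⟩, rfl⟩
    refine ⟨P, funext fun i => ?_⟩
    rw [cycleCutRow_eq hP, ← hc i]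
    have hzero : ∀ b : ZMod 2, ¬ b = 1 → 0 = b := by decide
    have hbit : ∀ (b : ZMod 2) [Decidable (b = 1)], (if b = 1 then 1 else 0) = b := by
      intro b _
      split_ifs with h
      · exact h.symm
      · exact hzero b h
    simp only [Set.mem_ofPred_eq, hbit]

/-- The exponents of `s_e` and `t_e` count the ones and zeros in the column of `e`. On two vertices
both indices name the same edge; its column merely appears twice. -/
theorem sum_cutExponent_cycleGraph_eq_iff [Fintype (cycleGraph (n + 2)).edgeSet]
    (s t : Multiset (UnorderedSplit (Fin (n + 2)))) :
    (s.map (cycleGraph (n + 2)).cutExponent).sum = (t.map (cycleGraph (n + 2)).cutExponent).sum ↔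
      SameColumns cycleCutRow s t := by
  classical
  rw [sum_cutExponent_eq_iff]
  have h1 : ∀ (i : Fin (n + 2)) (s : Multiset (UnorderedSplit (Fin (n + 2)))),
      s.countP (fun P => s(i, i + 1) ∈ (cycleGraph (n + 2)).cutSet P) =
        s.countP (fun P => cycleCutRow P i = 1) := fun i s =>
    Multiset.countP_congr rfl fun P _ => by simp [cycleCutRow]
  have h0 : ∀ (i : Fin (n + 2)) (s : Multiset (UnorderedSplit (Fin (n + 2)))),
      s.countP (fun P => s(i, i + 1) ∉ (cycleGraph (n + 2)).cutSet P) =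
        s.countP (fun P => cycleCutRow P i = 0) := fun i s =>
    Multiset.countP_congr rfl fun P _ => by simp [cycleCutRow]
  constructor
  · intro h i b
    obtain ⟨h2, h3⟩ := h ⟨s(i, i + 1), cycleGraph_adj_add_one i⟩
    rw [h1, h1] at h2
    rw [h0, h0] at h3
    have hb : b = 0 ∨ b = 1 := by
      revert b
      decide
    rcases hb with rfl | rfl
    · convert h3
    · convert h2
  · rintro h ⟨e, he⟩
    obtain ⟨i, rfl⟩ := exists_eq_of_mem_edgeSet_cycleGraph he
    dsimp only
    rw [h1, h1, h0, h0]
    exact ⟨by convert h i 1, by convert h i 0⟩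

end Cycle

end SimpleGraph

theorem mainTheorem5 (K : Type*) [Field K] (n : ℕ) (hn : 1 ≤ n) :
    (∃ B : Set (MvPolynomial (UnorderedSplit (Fin (n + 1))) K),
      (∀ f ∈ B, f.IsQuadraticBinomial) ∧
      ((SimpleGraph.cycleGraph (n + 1)).cutIdeal K).IsMinimalGeneratingSet B ∧
      B.encard = ((3 * Nat.stirlingSecond (n + 1) 4 : ℕ) : ℕ∞)) ∧
    (∀ S : Set (MvPolynomial (UnorderedSplit (Fin (n + 1))) K),
      Ideal.span S = (SimpleGraph.cycleGraph (n + 1)).cutIdeal K →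
      ((3 * Nat.stirlingSecond (n + 1) 4 : ℕ) : ℕ∞) ≤ S.encard) ∧
    (∀ S : Set (MvPolynomial (UnorderedSplit (Fin (n + 1))) K),
      (∀ f ∈ S, ∃ d : ℕ, f.IsHomogeneous d) →
      ((SimpleGraph.cycleGraph (n + 1)).cutIdeal K).IsMinimalGeneratingSet S →
      S.encard = ((3 * Nat.stirlingSecond (n + 1) 4 : ℕ) : ℕ∞)) := by
  -- With at least two vertices, `i` and `i + 1` are distinct, so every index gives an edge.
  obtain ⟨n, rfl⟩ : ∃ k, n = k + 1 := ⟨n - 1, by omega⟩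
  have : Finite (UnorderedSplit (Fin (n + 1 + 1))) :=
    Finite.of_injective _ SimpleGraph.cycleCutRow_injective
  obtain ⟨B, hquad, hli, hspan, hcard⟩ :=
    MvPolynomial.exists_quadraticBinomial_basis (K := K) SimpleGraph.cycleCutRow_injective
      SimpleGraph.exists_cycleCutRow_eq_iff
      ((SimpleGraph.cycleGraph (n + 1 + 1)).cutMap_X K)
      SimpleGraph.sum_cutExponent_cycleGraph_eq_iff
  rw [Fintype.card_fin] at hcard
  have hhom : ∀ b ∈ B, b.IsHomogeneous 2 := by
    intro b hb
    obtain ⟨a, c, -, ha, hc, rfl⟩ := hquad b hb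
    exact (isHomogeneous_monomial 1 ha).sub (isHomogeneous_monomial 1 hc)
  have hfin : B.Finite := Set.finite_of_encard_eq_coe hcard
  refine ⟨⟨B, hquad, isMinimalGeneratingSet_of_linearIndepOn hfin hli hhom hspan, hcard⟩,
    fun S hS => ?_, fun S hShom hS => ?_⟩
  · rw [← hcard]
    exact encard_le_encard_of_span_eq hli hhom hspan hS
  · rw [← hcard]
    exact encard_eq_of_isMinimalGeneratingSet hli hhom hspan hShom hS
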